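/- **Theorem.** Let $d,n,m_k\ge 1$ and let $\mathcal H=\ell^2(\mathbb Z^d)\otimes\mathbb C^{n}$ (for $n=1$ this is $\ell^2(\mathbb Z^d)$). Let $(\Delta f)(x)=\sum_{|y-x|_1=1}f(y)$ be the discrete Laplacian and $\mathcal L=\Delta\otimes A$ with $A$ a Hermitian positive-definite $n\times n$ matrix (for instance $A=I$). Let $\mathcal J\subset\mathbb Z^d$ be a sublattice, $P_0$ an orthogonal projection on $\mathcal H$ of rank $m_k$, and $P_i=U_iP_0U_i^{-1}$ for $i\in\mathcal J$, where $(U_if)(x)=f(x+i)$; assume that $\sum_{i\in\mathcal J}P_i=I$ strongly. Let $(\omega_i)_{i\in\mathcal J}$ be independent, identically distributed real random variables whose common law has a bounded density of compact support, and let $$H^\omega=\mathcal L+\sum_{i\in\mathcal J}\omega_iP_i .$$ For $L\in\mathbb N$ let $\Lambda_L=\{x\in\mathbb Z^d:|x|_\infty\le L\}$ and let $H_{\omega,L}=\chi_{\Lambda_L}H^\omega\chi_{\Lambda_L}$, acting on $\ell^2(\Lambda_L)\otimes\mathbb C^n$. Say that $H^\omega$ is localized in an open interval $I$ if there is $\nu>0$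 such that for every $p>0$ there are $q>0$ and $L_0$ with the following property: for all $L>L_0$, with probability greater than $1-L^{-p}$, the operator $H_{\omega,L}$ has an orthonormal basis of eigenvectors such that every $\varphi$ in this basis with eigenvalue in $I$ satisfies $$|\varphi(x)|\le L^{q}e^{-\nu|x-x_0|_\infty}\qquad(x\in\Lambda_L)$$ for every maximum point $x_0\in\Lambda_L$ of $x\mapsto|\varphi(x)|$. Let $\Sigma_{\rm CL}$ (the localization regime) be the set of all $E\in\mathbb R$ that have an open interval around them in which $H^\omega$ is localized. Then, with probability one, for every $E\in\Sigma_{\rm CL}$ the space $\ker(H^\omega-E)$ has dimension at most $m_k$; that is, almost surely all eigenvalues of $H^\omega$ in $\Sigma_{\rm CL}$ have multiplicity at most $m_k$. -/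

import Mathlib

open MeasureTheory ProbabilityTheory
open scoped ENNReal ComplexOrder

noncomputable section

namespace AndersonModel

/-- The Hilbert space `ℓ²(ℤᵈ) ⊗ ℂⁿ`, i.e. the square summable functions `ℤᵈ → ℂⁿ`.
For `n = 1` this is `ℓ²(ℤᵈ)`. -/
abbrev StateSpace (d n : ℕ) : Type :=
  lp (fun _ : Fin d → ℤ => EuclideanSpace ℂ (Fin n)) 2

/-- Square summability is invariant under translations. -/
theorem memℓp_shift {d n : ℕ} (i : Fin d → ℤ) (f : StateSpace d n) :
    Memℓp (fun k : Fin d → ℤ => f (k + i)) 2 := by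
  have hp : (0 : ℝ) < (2 : ℝ≥0∞).toReal := by norm_num
  rw [memℓp_gen_iff hp]
  exact ((Equiv.addRight i).summable_iff).2 ((lp.memℓp f).summable hp)

/-- Translations preserve the norm. -/
theorem norm_shift {d n : ℕ} (i : Fin d → ℤ) (f : StateSpace d n) :
    ‖(⟨fun k => f (k + i), memℓp_shift i f⟩ : StateSpace d n)‖ = ‖f‖ := by
  have hp : (0 : ℝ) < (2 : ℝ≥0∞).toReal := by norm_num
  rw [lp.norm_eq_tsum_rpow hp, lp.norm_eq_tsum_rpow hp]
  congr 1
  exact (Equiv.addRight i).tsum_eq (fun k => ‖f k‖ ^ (2 : ℝ≥0∞).toReal)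

/-- The unitary translation operator `(Uᵢ f)(k) = f (k + i)`. -/
def translation {d n : ℕ} (i : Fin d → ℤ) : StateSpace d n ≃ₗᵢ[ℂ] StateSpace d n where
  toFun f := ⟨fun k => f (k + i), memℓp_shift i f⟩
  invFun f := ⟨fun k => f (k + -i), memℓp_shift (-i) f⟩
  map_add' _ _ := rfl
  map_smul' _ _ := rfl
  left_inv f := by ext1; funext k; simp
  right_inv f := by ext1; funext k; simp
  norm_map' f := norm_shift i f

@[simp]
theorem translation_apply {d n : ℕ} (i : Fin d → ℤ) (f : StateSpace d n) (k : Fin d → ℤ) :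
    translation i f k = f (k + i) := rfl

/-- Applying a fixed matrix in every fibre preserves square summability. -/
theorem memℓp_fiber {d n : ℕ} (A : Matrix (Fin n) (Fin n) ℂ) (f : StateSpace d n) :
    Memℓp (fun k : Fin d → ℤ => Matrix.toEuclideanCLM (𝕜 := ℂ) A (f k)) 2 := by
  have hp : (0 : ℝ) < (2 : ℝ≥0∞).toReal := by norm_num
  have hf := ((lp.memℓp f).summable hp).mul_left
    (‖Matrix.toEuclideanCLM (𝕜 := ℂ) A‖ ^ (2 : ℝ≥0∞).toReal)
  rw [memℓp_gen_iff hp]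
  refine Summable.of_nonneg_of_le (fun k => by positivity) (fun k => ?_) hf
  rw [← Real.mul_rpow (norm_nonneg _) (norm_nonneg _)]
  exact Real.rpow_le_rpow (norm_nonneg _) (ContinuousLinearMap.le_opNorm _ _) hp.le

/-- The operator `1 ⊗ A` on `ℓ²(ℤᵈ) ⊗ ℂⁿ`: apply the matrix `A` to `f k` for each `k`. -/
def fiberOperator {d n : ℕ} (A : Matrix (Fin n) (Fin n) ℂ) :
    StateSpace d n →L[ℂ] StateSpace d n :=
  LinearMap.mkContinuous
    { toFun := fun f => ⟨fun k => Matrix.toEuclideanCLM (𝕜 := ℂ) A (f k), memℓp_fiber A f⟩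
      map_add' := fun f g => by ext1; funext k; exact map_add _ (f k) (g k)
      map_smul' := fun c f => by ext1; funext k; exact map_smul _ c (f k) }
    ‖Matrix.toEuclideanCLM (𝕜 := ℂ) A‖
    (fun f => by
      have hp : (0 : ℝ) < (2 : ℝ≥0∞).toReal := by norm_num
      refine lp.norm_le_of_forall_sum_le hp (by positivity) (fun s => ?_)
      rw [Real.mul_rpow (norm_nonneg _) (norm_nonneg _)]
      refine le_trans ?_ (mul_le_mul_of_nonneg_left (lp.sum_rpow_le_norm_rpow hp f s)
        (by positivity))
      rw [Finset.mul_sum]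
      refine Finset.sum_le_sum (fun k _ => ?_)
      rw [← Real.mul_rpow (norm_nonneg _) (norm_nonneg _)]
      exact Real.rpow_le_rpow (norm_nonneg _) (ContinuousLinearMap.le_opNorm _ _) hp.le)

@[simp]
theorem fiberOperator_apply {d n : ℕ} (A : Matrix (Fin n) (Fin n) ℂ) (f : StateSpace d n)
    (k : Fin d → ℤ) : fiberOperator A f k = Matrix.toEuclideanCLM (𝕜 := ℂ) A (f k) := rfl

/-- The kinetic operator `Δ ⊗ A`, where `Δ` is the discrete Laplacian (the adjacency operator)
`(Δ f)(k) = ∑_{|k' - k|₁ = 1} f k'` on `ℤᵈ`, with spectrum `[-2d, 2d]`. -/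
def laplacian {d n : ℕ} (A : Matrix (Fin n) (Fin n) ℂ) : StateSpace d n →L[ℂ] StateSpace d n :=
  ∑ a : Fin d,
    ((translation (n := n) (Pi.single a 1)).toContinuousLinearEquiv.toContinuousLinearMap
      + (translation (n := n) (-Pi.single a 1)).toContinuousLinearEquiv.toContinuousLinearMap)
      ∘L fiberOperator A

/-- `((Δ ⊗ A) f)(k) = ∑ₐ (A f(k + eₐ) + A f(k - eₐ))`. -/
theorem laplacian_apply {d n : ℕ} (A : Matrix (Fin n) (Fin n) ℂ) (f : StateSpace d n)
    (k : Fin d → ℤ) :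
    laplacian A f k = ∑ a : Fin d,
      (Matrix.toEuclideanCLM (𝕜 := ℂ) A (f (k + Pi.single a 1)) +
        Matrix.toEuclideanCLM (𝕜 := ℂ) A (f (k - Pi.single a 1))) := by
  rw [laplacian, _root_.sum_apply, lp.coeFn_sum, Finset.sum_apply]
  exact Finset.sum_congr rfl fun a _ => rfl

/-- The translated projection `Pᵢ = Uᵢ P₀ Uᵢ⁻¹`. -/
def translatedProjection {d n : ℕ} (P₀ : StateSpace d n →L[ℂ] StateSpace d n) (i : Fin d → ℤ) :
    StateSpace d n →L[ℂ] StateSpace d n :=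
  (translation (n := n) i).toContinuousLinearEquiv.toContinuousLinearMap ∘L P₀ ∘L
    (translation (n := n) i).symm.toContinuousLinearEquiv.toContinuousLinearMap

theorem translatedProjection_apply {d n : ℕ} (P₀ : StateSpace d n →L[ℂ] StateSpace d n)
    (i : Fin d → ℤ) (f : StateSpace d n) :
    translatedProjection P₀ i f = translation i (P₀ ((translation i).symm f)) := rfl

open Classical in
/-- The potential `V = ∑_{i ∈ J} wᵢ Pᵢ`, the sum being taken in the strong operator topology (it
exists for every bounded configuration `w`, see `potential_hasSum`; if the sum does not exist the
value is `0`). -/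
def potential {d n : ℕ} (J : AddSubgroup (Fin d → ℤ))
    (P₀ : StateSpace d n →L[ℂ] StateSpace d n) (w : J → ℝ) :
    StateSpace d n →L[ℂ] StateSpace d n :=
  if h : ∃ V : StateSpace d n →L[ℂ] StateSpace d n,
      ∀ f, HasSum (fun i : J => (w i : ℂ) • translatedProjection P₀ (i : Fin d → ℤ) f) (V f)
  then h.choose else 0

/-- The generalized Anderson Hamiltonian `H = Δ ⊗ A + ∑_{i ∈ J} wᵢ Pᵢ`. -/
def hamiltonian {d n : ℕ} (A : Matrix (Fin n) (Fin n) ℂ) (J : AddSubgroup (Fin d → ℤ))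
    (P₀ : StateSpace d n →L[ℂ] StateSpace d n) (w : J → ℝ) :
    StateSpace d n →L[ℂ] StateSpace d n :=
  laplacian A + potential J P₀ w

/-- The cube `Λ_L = {x ∈ ℤᵈ : |x|_∞ ≤ L}`. -/
def box (d L : ℕ) : Set (Fin d → ℤ) := {x | ∀ a, |x a| ≤ (L : ℤ)}

/-- `ℓ²(Λ_L) ⊗ ℂⁿ`, as the subspace of functions vanishing outside `Λ_L`. -/
def boxSpace (d n L : ℕ) : Submodule ℂ (StateSpace d n) where
  carrier := {f | ∀ x, x ∉ box d L → f x = 0}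
  zero_mem' := fun _ _ => rfl
  add_mem' := fun {f g} hf hg x hx => by
    rw [lp.coeFn_add, Pi.add_apply, hf x hx, hg x hx, add_zero]
  smul_mem' := fun c f hf x hx => by
    rw [lp.coeFn_smul, Pi.smul_apply, hf x hx, smul_zero]

/-- `φ` is an eigenvector with eigenvalue `e` of the finite volume operator
`χ_{Λ_L} H χ_{Λ_L}` acting on `ℓ²(Λ_L) ⊗ ℂⁿ`. -/
def IsBoxEigenvector {d n : ℕ} (H : StateSpace d n →L[ℂ] StateSpace d n) (L : ℕ) (e : ℝ)
    (φ : StateSpace d n) : Prop :=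
  φ ∈ boxSpace d n L ∧ φ ≠ 0 ∧ ∀ x ∈ box d L, H φ x = (e : ℂ) • φ x

/-- Localization of the finite volume operator `χ_{Λ_L} H χ_{Λ_L}` in the energy set `I`: it has an
orthonormal basis of eigenvectors such that each `φ` of them whose eigenvalue is in `I` satisfies
`|φ(x)| ≤ L^q e^{-ν ‖x - x₀‖}` on `Λ_L` for every maximum point `x₀` (localization center) of
`|φ|`. -/
def BoxLocalized {d n : ℕ} (H : StateSpace d n →L[ℂ] StateSpace d n) (I : Set ℝ) (ν q : ℝ)
    (L : ℕ) : Prop :=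
  ∃ (N : ℕ) (φ : Fin N → StateSpace d n) (e : Fin N → ℝ),
    Orthonormal ℂ φ ∧
    Submodule.span ℂ (Set.range φ) = boxSpace d n L ∧
    (∀ j, IsBoxEigenvector H L (e j) (φ j)) ∧
    ∀ j, e j ∈ I → ∀ x₀ ∈ box d L, (∀ x ∈ box d L, ‖φ j x‖ ≤ ‖φ j x₀‖) →
      ∀ x ∈ box d L, ‖φ j x‖ ≤ (L : ℝ) ^ q * Real.exp (-ν * ‖x - x₀‖)

/-- Complete localization of a random operator `H` in the energy set `I`: there is a rate `ν > 0`
such that for every `p > 0` there are `q > 0` and a length scale `L₀` such that, for all `L > L₀`,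
with probability greater than `1 - L^{-p}` the finite volume operator on `Λ_L` is localized in `I`
with the rate `ν` and the prefactor `L^q`. -/
def LocalizedIn {d n : ℕ} {Ω : Type*} [MeasurableSpace Ω] (μ : Measure Ω)
    (H : Ω → StateSpace d n →L[ℂ] StateSpace d n) (I : Set ℝ) : Prop :=
  ∃ ν : ℝ, 0 < ν ∧ ∀ p : ℝ, 0 < p → ∃ q : ℝ, 0 < q ∧ ∃ L₀ : ℕ, ∀ L : ℕ, L₀ < L →
    μ {ω | ¬ BoxLocalized (H ω) I ν q L} < ENNReal.ofReal ((L : ℝ) ^ (-p))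

/-- The region of complete localization: the energies that have an open interval around them in
which the random operator is localized. -/
def localizationRegion {d n : ℕ} {Ω : Type*} [MeasurableSpace Ω] (μ : Measure Ω)
    (H : Ω → StateSpace d n →L[ℂ] StateSpace d n) : Set ℝ :=
  {E | ∃ a b : ℝ, a < E ∧ E < b ∧ LocalizedIn μ H (Set.Ioo a b)}

section Facts

variable {d n : ℕ} {J : AddSubgroup (Fin d → ℤ)} {P₀ : StateSpace d n →L[ℂ] StateSpace d n}

/-- `⟪f, Pᵢ g⟫ = ⟪Pᵢ f, Pᵢ g⟫`. -/
theorem inner_translatedProjection (hP₀ : IsStarProjection P₀) (i : Fin d → ℤ)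
    (f g : StateSpace d n) :
    inner ℂ f (translatedProjection P₀ i g) =
      inner ℂ (translatedProjection P₀ i f) (translatedProjection P₀ i g) := by
  have h1 : ∀ u v : StateSpace d n, inner ℂ (P₀ u) (P₀ v) = inner ℂ u (P₀ v) := by
    intro u v
    have hs := ContinuousLinearMap.isSelfAdjoint_iff_isSymmetric.1 hP₀.isSelfAdjoint
    have hi : P₀ (P₀ v) = P₀ v := congrArg (fun T => T v) hP₀.isIdempotentElem.eq
    have := hs u (P₀ v)
    simp only [ContinuousLinearMap.coe_coe, hi] at this
    exact this
  simp only [translatedProjection_apply, LinearIsometryEquiv.inner_map_map, h1]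
  conv_lhs => rw [← LinearIsometryEquiv.apply_symm_apply (translation i) f]
  rw [LinearIsometryEquiv.inner_map_map]

/-- `∑ᵢ ‖Pᵢ f‖² = ‖f‖²`. -/
theorem hasSum_norm_sq (hP₀ : IsStarProjection P₀)
    (hsum : ∀ f, HasSum (fun i : J => translatedProjection P₀ (i : Fin d → ℤ) f) f)
    (f : StateSpace d n) :
    HasSum (fun i : J => ‖translatedProjection P₀ (i : Fin d → ℤ) f‖ ^ 2) (‖f‖ ^ 2) := by
  have h := ((hsum f).mapL (innerSL ℂ f)).mapL Complex.reCLM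
  have h2 : Complex.reCLM ((innerSL ℂ f) f) = ‖f‖ ^ 2 := by
    simpa using inner_self_eq_norm_sq (𝕜 := ℂ) f
  rw [h2] at h
  convert h using 2 with i
  rw [innerSL_apply_apply, inner_translatedProjection hP₀]
  exact (inner_self_eq_norm_sq (𝕜 := ℂ) _).symm

/-- An elementary inequality. -/
theorem le_of_sq_le_mul {x y s b : ℝ} (hx : 0 ≤ x) (h1 : x ≤ s) (h2 : s ^ 2 ≤ y * b)
    (h3 : y ≤ x) (hb : 0 ≤ b) : x ≤ b := by
  rcases hx.eq_or_lt with h0 | h0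
  · rwa [← h0]
  · exact le_of_mul_le_mul_left (by nlinarith [mul_le_mul_of_nonneg_right h3 hb]) h0

/-- The finite partial sums satisfy `‖∑_{i ∈ S} wᵢ Pᵢ f‖² ≤ C² ∑_{i ∈ S} ‖Pᵢ f‖²`. -/
theorem norm_partialSum_sq_le (hP₀ : IsStarProjection P₀)
    (hsum : ∀ f, HasSum (fun i : J => translatedProjection P₀ (i : Fin d → ℤ) f) f)
    {w : J → ℝ} {C : ℝ} (hw : ∀ i, |w i| ≤ C) (S : Finset J) (f : StateSpace d n) :
    ‖∑ i ∈ S, (w i : ℂ) • translatedProjection P₀ (i : Fin d → ℤ) f‖ ^ 2 ≤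
      C ^ 2 * ∑ i ∈ S, ‖translatedProjection P₀ (i : Fin d → ℤ) f‖ ^ 2 := by
  set v := ∑ i ∈ S, (w i : ℂ) • translatedProjection P₀ (i : Fin d → ℤ) f with hv
  set B := ∑ i ∈ S, ‖translatedProjection P₀ (i : Fin d → ℤ) f‖ ^ 2 with hB
  have hB0 : 0 ≤ B := Finset.sum_nonneg fun _ _ => by positivity
  have hvS : ∑ i ∈ S, ‖translatedProjection P₀ (i : Fin d → ℤ) v‖ ^ 2 ≤ ‖v‖ ^ 2 :=
    sum_le_hasSum S (fun _ _ => by positivity) (hasSum_norm_sq hP₀ hsum v)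
  have h1 : ‖v‖ ^ 2 ≤ ∑ i ∈ S, ‖translatedProjection P₀ (i : Fin d → ℤ) v‖ *
      (C * ‖translatedProjection P₀ (i : Fin d → ℤ) f‖) := by
    have h2 : inner ℂ v v = ∑ i ∈ S, (w i : ℂ) * inner ℂ
        (translatedProjection P₀ (i : Fin d → ℤ) v)
        (translatedProjection P₀ (i : Fin d → ℤ) f) := by
      conv_lhs => rw [hv, inner_sum]
      refine Finset.sum_congr rfl fun i _ => ?_
      rw [inner_smul_right, ← hv, inner_translatedProjection hP₀]
    have h3 : ‖v‖ ^ 2 = ‖inner ℂ v v‖ := by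
      rw [inner_self_eq_norm_sq_to_K]; simp
    rw [h3, h2]
    refine (norm_sum_le _ _).trans (Finset.sum_le_sum fun i _ => ?_)
    rw [norm_mul, Complex.norm_real, Real.norm_eq_abs]
    have h4 := norm_inner_le_norm (𝕜 := ℂ) (translatedProjection P₀ (i : Fin d → ℤ) v)
      (translatedProjection P₀ (i : Fin d → ℤ) f)
    calc |w i| * ‖_‖ ≤ C * (‖translatedProjection P₀ (i : Fin d → ℤ) v‖ *
          ‖translatedProjection P₀ (i : Fin d → ℤ) f‖) :=
          mul_le_mul (hw i) h4 (norm_nonneg _) ((abs_nonneg _).trans (hw i))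
      _ = _ := by ring
  have h5 := Finset.sum_mul_sq_le_sq_mul_sq S
    (fun i => ‖translatedProjection P₀ (i : Fin d → ℤ) v‖)
    (fun i => C * ‖translatedProjection P₀ (i : Fin d → ℤ) f‖)
  have h6 : ∑ i ∈ S, (C * ‖translatedProjection P₀ (i : Fin d → ℤ) f‖) ^ 2 = C ^ 2 * B := by
    rw [hB, Finset.mul_sum]
    exact Finset.sum_congr rfl fun i _ => by ring
  rw [h6] at h5
  exact le_of_sq_le_mul (sq_nonneg _) h1 h5 hvS (mul_nonneg (sq_nonneg C) hB0)

/-- For a bounded configuration the series defining the potential converges strongly. -/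
theorem potential_hasSum (hP₀ : IsStarProjection P₀)
    (hsum : ∀ f, HasSum (fun i : J => translatedProjection P₀ (i : Fin d → ℤ) f) f)
    {w : J → ℝ} {C : ℝ} (hw : ∀ i, |w i| ≤ C) (f : StateSpace d n) :
    HasSum (fun i : J => (w i : ℂ) • translatedProjection P₀ (i : Fin d → ℤ) f)
      (potential J P₀ w f) := by
  have hS : ∀ g : StateSpace d n,
      Summable fun i : J => (w i : ℂ) • translatedProjection P₀ (i : Fin d → ℤ) g := by
    intro g
    rw [summable_iff_vanishing_norm]
    intro ε hε
    obtain ⟨s, hs⟩ := summable_iff_vanishing_norm.1 (hasSum_norm_sq hP₀ hsum g).summable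
      (ε ^ 2 / (C ^ 2 + 1)) (by positivity)
    refine ⟨s, fun t ht => ?_⟩
    have h1 := norm_partialSum_sq_le hP₀ hsum hw t g
    have h2 := (le_abs_self _).trans_lt (hs t ht)
    rw [lt_div_iff₀ (by positivity)] at h2
    have h3 : 0 ≤ ∑ i ∈ t, ‖translatedProjection P₀ (i : Fin d → ℤ) g‖ ^ 2 :=
      Finset.sum_nonneg fun _ _ => by positivity
    exact lt_of_pow_lt_pow_left₀ 2 hε.le (by nlinarith)
  have hex : ∃ V : StateSpace d n →L[ℂ] StateSpace d n,
      ∀ f, HasSum (fun i : J => (w i : ℂ) • translatedProjection P₀ (i : Fin d → ℤ) f) (V f) := by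
    refine ⟨LinearMap.mkContinuous
      { toFun := fun g => ∑' i : J, (w i : ℂ) • translatedProjection P₀ (i : Fin d → ℤ) g
        map_add' := fun g h => ?_
        map_smul' := fun c g => ?_ } |C| (fun g => ?_), fun g => (hS g).hasSum⟩
    · rw [← (hS g).tsum_add (hS h)]
      simp only [map_add, smul_add]
    · rw [RingHom.id_apply, ← (hS g).tsum_const_smul]
      simp only [map_smul, smul_comm c]
    · refine le_of_tendsto (hS g).hasSum.norm (Filter.Eventually.of_forall fun t => ?_)
      refine (sq_le_sq₀ (norm_nonneg _) (by positivity)).1 ?_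
      refine (norm_partialSum_sq_le hP₀ hsum hw t g).trans ?_
      rw [mul_pow, sq_abs]
      exact mul_le_mul_of_nonneg_left
        (sum_le_hasSum t (fun _ _ => by positivity) (hasSum_norm_sq hP₀ hsum g)) (sq_nonneg C)
  rw [potential, dif_pos hex]
  exact hex.choose_spec f

end Facts

end AndersonModel

end

open Topology

namespace AndersonModel

/-! ### Componentwise solutions, the Wronskian identity and countability -/

section Abstract

variable {H : Type*} [NormedAddCommGroup H] [InnerProductSpace ℂ H] {ι : Type*}

/-- The componentwise form of the eigenvalue equation `T ψ + ∑ⱼ wⱼ Pⱼ ψ = E ψ`. -/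
def IsComponentwiseSolution (T : H →L[ℂ] H) (P : ι → H →L[ℂ] H) (w : ι → ℝ) (E : ℝ) (ψ : H) :
    Prop :=
  ∀ j, P j (T ψ) = ((E - w j : ℝ) : ℂ) • P j ψ

/-- The componentwise eigenvalue equation for the linear form `⟪ψ, ·⟫`. -/
def IsDualSolution (T : H →L[ℂ] H) (P : ι → H →L[ℂ] H) (w : ι → ℝ) (E : ℝ)
    (f : WeakDual ℂ H) : Prop :=
  ∀ j g, f (T (P j g)) = ((E - w j : ℝ) : ℂ) * f (P j g)

variable {T : H →L[ℂ] H} {P : ι → H →L[ℂ] H}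

theorem IsComponentwiseSolution.smul {w : ι → ℝ} {E : ℝ} {ψ : H}
    (h : IsComponentwiseSolution T P w E ψ) (c : ℂ) :
    IsComponentwiseSolution T P w E (c • ψ) := by
  intro j
  rw [map_smul, map_smul, map_smul, h j, smul_comm]

/-- Nonzero pairwise orthogonal vectors in a separable space form a countable family. -/
theorem countable_of_pairwise_orthogonal [TopologicalSpace.SeparableSpace H] {α : Type*}
    {s : Set α} {v : α → H} (h0 : ∀ a ∈ s, v a ≠ 0)
    (h : ∀ a ∈ s, ∀ b ∈ s, a ≠ b → inner ℂ (v a) (v b) = 0) : s.Countable := by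
  -- These balls are disjoint: by Pythagoras the squared distance of the centres is `‖v a‖² + ‖v
  -- b‖²`, which exceeds the square of the sum of the radii.
  refine Set.PairwiseDisjoint.countable_of_isOpen (s := fun a => Metric.ball (v a) (‖v a‖ / 2))
    ?_ (fun _ _ => Metric.isOpen_ball)
    (fun a ha => ⟨v a, Metric.mem_ball_self (half_pos (norm_pos_iff.2 (h0 a ha)))⟩)
  intro a ha b hb hab
  refine Set.disjoint_left.2 fun x hxa hxb => ?_
  have h1 : ‖v a - v b‖ < ‖v a‖ / 2 + ‖v b‖ / 2 := by
    rw [← dist_eq_norm]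
    exact (dist_triangle_left _ _ x).trans_lt (add_lt_add hxa hxb)
  have h2 : ‖v a - v b‖ * ‖v a - v b‖ = ‖v a‖ * ‖v a‖ + ‖v b‖ * ‖v b‖ := by
    rw [@norm_sub_mul_self ℂ, h a ha b hb hab]
    simp
  nlinarith [norm_nonneg (v a), norm_nonneg (v b), norm_nonneg (v a - v b),
    sq_nonneg (‖v a‖ - ‖v b‖), norm_pos_iff.2 (h0 a ha)]

/-- The Wronskian identity for two componentwise solutions. -/
theorem IsComponentwiseSolution.hasSum_inner
    (hT : ∀ x y, inner ℂ (T x) y = inner ℂ x (T y))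
    (hPs : ∀ j x y, inner ℂ (P j x) y = inner ℂ x (P j y))
    (hsum : ∀ x, HasSum (fun j => P j x) x)
    {w w' : ι → ℝ} {E E' : ℝ} {ψ φ : H} (hψ : IsComponentwiseSolution T P w E ψ)
    (hφ : IsComponentwiseSolution T P w' E' φ) :
    HasSum (fun j => (((E - w j) - (E' - w' j) : ℝ) : ℂ) * inner ℂ φ (P j ψ)) 0 := by
  -- Expand `⟪φ, T ψ⟫` and `⟪T φ, ψ⟫` along `∑ Pⱼ = I`; the two are equal by symmetry of `T`, so the
  -- series of differences sums to zero.
  have h1 := (hsum (T ψ)).mapL (innerSL ℂ φ)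
  have h2 := ((hsum (T φ)).mapL (innerSL ℂ ψ)).star
  have h3 := h1.sub h2
  simp only [innerSL_apply_apply, hψ _, hφ _, inner_smul_right] at h3
  rw [← hT φ ψ, show star (inner ℂ ψ (T φ)) = inner ℂ (T φ) ψ from inner_conj_symm _ _,
    sub_self] at h3
  refine HasSum.congr_fun h3 fun j => ?_
  have : star (inner ℂ ψ (P j φ)) = inner ℂ φ (P j ψ) := by
    rw [← hPs]; exact inner_conj_symm _ _
  rw [star_mul', this]
  simp only [Complex.star_def, Complex.conj_ofReal]
  push_cast
  ring

/-- Componentwise solutions for distinct energies are orthogonal. -/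
theorem IsComponentwiseSolution.inner_eq_zero
    (hT : ∀ x y, inner ℂ (T x) y = inner ℂ x (T y))
    (hPs : ∀ j x y, inner ℂ (P j x) y = inner ℂ x (P j y))
    (hsum : ∀ x, HasSum (fun j => P j x) x)
    {w : ι → ℝ} {E E' : ℝ} {ψ φ : H} (hψ : IsComponentwiseSolution T P w E ψ)
    (hφ : IsComponentwiseSolution T P w E' φ) (hE : E ≠ E') : inner ℂ φ ψ = 0 := by
  have h1 := hψ.hasSum_inner hT hPs hsum hφ
  have h2 := ((hsum ψ).mapL (innerSL ℂ φ)).mul_left ((E - E' : ℝ) : ℂ)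
  have h3 := h1.unique (a₂ := ((E - E' : ℝ) : ℂ) * inner ℂ φ ψ) (by
    refine HasSum.congr_fun h2 fun j => ?_
    rw [innerSL_apply_apply, sub_sub_sub_cancel_right])
  exact (mul_eq_zero.1 h3.symm).resolve_left (Complex.ofReal_ne_zero.2 (sub_ne_zero.2 hE))

/-- If the coupling constants differ only at `i`, then the `i`-th components of componentwise
solutions with the same energy are orthogonal. -/
theorem IsComponentwiseSolution.inner_component_eq_zero [DecidableEq ι]
    (hT : ∀ x y, inner ℂ (T x) y = inner ℂ x (T y))
    (hPs : ∀ j x y, inner ℂ (P j x) y = inner ℂ x (P j y))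
    (hPi : ∀ j x, P j (P j x) = P j x)
    (hsum : ∀ x, HasSum (fun j => P j x) x)
    {w : ι → ℝ} {E s t : ℝ} {i : ι} {ψ φ : H}
    (hψ : IsComponentwiseSolution T P (Function.update w i s) E ψ)
    (hφ : IsComponentwiseSolution T P (Function.update w i t) E φ) (hst : s ≠ t) :
    inner ℂ (P i φ) (P i ψ) = 0 := by
  have h1 := hψ.hasSum_inner hT hPs hsum hφ
  -- Energies and couplings agree off `i`, so the Wronskian series has only its `i`-th term, with
  -- coefficient `t - s`.
  have h2 := h1.unique (hasSum_single i fun j hj => by simp [Function.update_of_ne hj])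
  rw [Function.update_self, Function.update_self] at h2
  rw [hPs, hPi]
  refine (mul_eq_zero.1 h2.symm).resolve_left (Complex.ofReal_ne_zero.2 ?_)
  rw [sub_sub_sub_cancel_left]
  exact sub_ne_zero.2 hst.symm

/-- The coupling `w i` enters only as a factor of `P i ψ`, which is zero here. -/
theorem IsComponentwiseSolution.update [DecidableEq ι] {w : ι → ℝ} {E : ℝ} {i : ι} {ψ : H}
    (hψ : IsComponentwiseSolution T P w E ψ) (hi : P i ψ = 0) (t : ℝ) :
    IsComponentwiseSolution T P (Function.update w i t) E ψ := by
  intro j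
  rcases eq_or_ne j i with rfl | hj
  · rw [hψ j, hi, smul_zero, smul_zero]
  · rw [hψ j, Function.update_of_ne hj]

/-- For fixed other coupling constants, only countably many values of the `i`-th one allow for two
solutions with equal energy, one with vanishing and one with nonvanishing `i`-th component. -/
theorem countable_resonances [TopologicalSpace.SeparableSpace H] [DecidableEq ι]
    (hT : ∀ x y, inner ℂ (T x) y = inner ℂ x (T y))
    (hPs : ∀ j x y, inner ℂ (P j x) y = inner ℂ x (P j y))
    (hPi : ∀ j x, P j (P j x) = P j x)
    (hsum : ∀ x, HasSum (fun j => P j x) x) (w : ι → ℝ) (i : ι) :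
    {t : ℝ | ∃ E ψ φ, IsComponentwiseSolution T P (Function.update w i t) E ψ ∧
      IsComponentwiseSolution T P (Function.update w i t) E φ ∧
      ψ ≠ 0 ∧ P i ψ = 0 ∧ P i φ ≠ 0}.Countable := by
  have hC : {E : ℝ | ∃ ψ, IsComponentwiseSolution T P (Function.update w i 0) E ψ ∧
      ψ ≠ 0 ∧ P i ψ = 0}.Countable := by
    choose! v hv using fun (E : ℝ)
      (hE : E ∈ {E : ℝ | ∃ ψ, IsComponentwiseSolution T P (Function.update w i 0) E ψ ∧
      ψ ≠ 0 ∧ P i ψ = 0}) => hE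
    exact countable_of_pairwise_orthogonal (v := v) (fun E hE => (hv E hE).2.1)
      fun E hE E' hE' hne => (hv E' hE').1.inner_eq_zero hT hPs hsum (hv E hE).1 hne.symm
  have hD : ∀ E : ℝ, {t : ℝ | ∃ φ, IsComponentwiseSolution T P (Function.update w i t) E φ ∧
      P i φ ≠ 0}.Countable := by
    intro E
    choose! v hv using fun (t : ℝ)
      (ht : t ∈ {t : ℝ | ∃ φ, IsComponentwiseSolution T P (Function.update w i t) E φ ∧
      P i φ ≠ 0}) => ht
    exact countable_of_pairwise_orthogonal (v := fun t => P i (v t)) (fun t ht => (hv t ht).2)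
      fun s hs t ht hne =>
        (hv t ht).1.inner_component_eq_zero hT hPs hPi hsum (hv s hs).1 hne.symm
  refine (hC.biUnion fun E _ => hD E).mono ?_
  rintro t ⟨E, ψ, φ, hψ, hφ, h0, hi, hne⟩
  refine Set.mem_biUnion (x := E) ⟨ψ, ?_, h0, hi⟩ ⟨φ, hφ, hne⟩
  -- Resetting the `i`-th coupling to the reference value `0` puts `E` into a set that does not
  -- depend on `t`.
  simpa using hψ.update hi 0

/-! ### Measurability of the bad configurations by weak-* compactness -/

/-- The configurations `w` for which there are two dual solutions in the unit ball, with the same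
energy in `[-N, N]`, the first one vanishing on the range of `P i` and the second one not; the
nonvanishing is tested on `u` and `v` with the threshold `1 / N`. -/
def resonanceSet (T : H →L[ℂ] H) (P : ι → H →L[ℂ] H) (i : ι) (N : ℕ) (u v : H) :
    Set (ι → ℝ) :=
  {w | ∃ E ∈ Set.Icc (-N : ℝ) N,
    ∃ f ∈ WeakDual.toStrongDual ⁻¹' Metric.closedBall (0 : StrongDual ℂ H) 1,
    ∃ f' ∈ WeakDual.toStrongDual ⁻¹' Metric.closedBall (0 : StrongDual ℂ H) 1,
    IsDualSolution T P w E f ∧ IsDualSolution T P w E f' ∧ (∀ g, f (P i g) = 0) ∧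
    1 ≤ N * ‖f u‖ ∧ 1 ≤ N * ‖f' (P i v)‖}

/-- By Banach–Alaoglu the triples `(E, f, f')` range over a compact set, and projection along a
compact factor is a closed map. Every condition evaluates the forms at fixed vectors, hence is
weak-* closed; the thresholds keep the forms from degenerating to zero in the limit. -/
theorem isClosed_resonanceSet (T : H →L[ℂ] H) (P : ι → H →L[ℂ] H) (i : ι) (N : ℕ) (u v : H) :
    IsClosed (resonanceSet T P i N u v) := by
  set B : Set (WeakDual ℂ H) :=
    WeakDual.toStrongDual ⁻¹' Metric.closedBall (0 : StrongDual ℂ H) 1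
  have hB : IsCompact B := WeakDual.isCompact_closedBall 0 1
  set K : Set (ℝ × WeakDual ℂ H × WeakDual ℂ H) := Set.Icc (-N : ℝ) N ×ˢ (B ×ˢ B)
  have : CompactSpace K := isCompact_iff_compactSpace.1 (isCompact_Icc.prod (hB.prod hB))
  have he : ∀ g : H, Continuous fun f : WeakDual ℂ H => f g := WeakDual.eval_continuous
  have hS : IsClosed {p : (ι → ℝ) × K | IsDualSolution T P p.1 p.2.1.1 p.2.1.2.1 ∧
      IsDualSolution T P p.1 p.2.1.1 p.2.1.2.2 ∧ (∀ g, p.2.1.2.1 (P i g) = 0) ∧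
      1 ≤ N * ‖p.2.1.2.1 u‖ ∧ 1 ≤ N * ‖p.2.1.2.2 (P i v)‖} := by
    have c1 : ∀ g : H, Continuous fun p : (ι → ℝ) × K => p.2.1.2.1 g := fun g =>
      (he g).comp (by fun_prop)
    have c2 : ∀ g : H, Continuous fun p : (ι → ℝ) × K => p.2.1.2.2 g := fun g =>
      (he g).comp (by fun_prop)
    have c3 : ∀ j, Continuous fun p : (ι → ℝ) × K => ((p.2.1.1 - p.1 j : ℝ) : ℂ) := fun j =>
      Complex.continuous_ofReal.comp (by fun_prop)
    simp only [IsDualSolution, Set.ofPred_and, Set.ofPred_forall]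
    refine IsClosed.inter ?_ (IsClosed.inter ?_ (IsClosed.inter ?_ (IsClosed.inter ?_ ?_)))
    · exact isClosed_iInter fun j => isClosed_iInter fun g =>
        isClosed_eq (c1 _) ((c3 j).mul (c1 _))
    · exact isClosed_iInter fun j => isClosed_iInter fun g =>
        isClosed_eq (c2 _) ((c3 j).mul (c2 _))
    · exact isClosed_iInter fun g => isClosed_eq (c1 _) continuous_const
    · exact isClosed_le continuous_const (continuous_const.mul (c1 _).norm)
    · exact isClosed_le continuous_const (continuous_const.mul (c2 _).norm)
  convert isClosedMap_fst_of_compactSpace _ hS using 1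
  ext w
  constructor
  · rintro ⟨E, hE, f, hf, f', hf', h⟩
    exact ⟨(w, ⟨(E, f, f'), hE, hf, hf'⟩), h, rfl⟩
  · rintro ⟨⟨w', ⟨⟨E, f, f'⟩, hE, hf, hf'⟩⟩, h, rfl⟩
    exact ⟨E, hE, f, hf, f', hf', h⟩

variable [CompleteSpace H]

/-- Vectors and linear forms give the same solutions. -/
theorem isDualSolution_toDual_iff (hT : ∀ x y, inner ℂ (T x) y = inner ℂ x (T y))
    (hPs : ∀ j x y, inner ℂ (P j x) y = inner ℂ x (P j y)) {w : ι → ℝ} {E : ℝ} {ψ : H} :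
    IsDualSolution T P w E (StrongDual.toWeakDual (InnerProductSpace.toDual ℂ H ψ)) ↔
      IsComponentwiseSolution T P w E ψ := by
  refine forall_congr' fun j => ?_
  rw [ext_iff_inner_right ℂ]
  refine forall_congr' fun g => ?_
  simp only [StrongDual.toWeakDual_apply, InnerProductSpace.toDual_apply_apply]
  rw [inner_smul_left, Complex.conj_ofReal, hPs, hPs, hT]

/-- With the next lemma, this exhibits the bad event as a countable union of closed sets: normalize
both solutions and detect their nonvanishing on a dense sequence. -/
theorem mem_resonanceSet_of_solutions (hT : ∀ x y, inner ℂ (T x) y = inner ℂ x (T y))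
    (hPs : ∀ j x y, inner ℂ (P j x) y = inner ℂ x (P j y)) {u : ℕ → H} (hu : DenseRange u)
    {w : ι → ℝ} {E : ℝ} {i : ι} {ψ φ : H}
    (hψ : IsComponentwiseSolution T P w E ψ) (hφ : IsComponentwiseSolution T P w E φ)
    (h0 : ψ ≠ 0) (hi : P i ψ = 0) (hne : P i φ ≠ 0) :
    ∃ N a b, w ∈ resonanceSet T P i N (u a) (u b) := by
  have hunit : ∀ χ : H, χ ≠ 0 → ‖((‖χ‖⁻¹ : ℝ) : ℂ) • χ‖ ≤ 1 := fun χ hχ => by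
    rw [norm_smul, Complex.norm_real, norm_inv, norm_norm, inv_mul_cancel₀ (norm_ne_zero_iff.2 hχ)]
  have hc : ∀ χ : H, χ ≠ 0 → ((‖χ‖⁻¹ : ℝ) : ℂ) ≠ 0 := fun χ hχ =>
    Complex.ofReal_ne_zero.2 (inv_ne_zero (norm_ne_zero_iff.2 hχ))
  have hφ0 : φ ≠ 0 := fun h => hne (by rw [h, map_zero])
  set ψ₁ := ((‖ψ‖⁻¹ : ℝ) : ℂ) • ψ
  set φ₁ := ((‖φ‖⁻¹ : ℝ) : ℂ) • φ
  have hψ₁ : ψ₁ ≠ 0 := smul_ne_zero (hc ψ h0) h0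
  have hφ₁ : P i φ₁ ≠ 0 := by rw [map_smul]; exact smul_ne_zero (hc φ hφ0) hne
  have hi₁ : P i ψ₁ = 0 := by rw [map_smul, hi, smul_zero]
  have hex : ∀ χ : H, χ ≠ 0 → ∃ a, inner ℂ χ (u a) ≠ 0 := by
    intro χ hχ
    by_contra! hcon
    exact hχ (hu.eq_zero_of_inner_left ℂ hcon)
  obtain ⟨a, ha⟩ := hex ψ₁ hψ₁
  obtain ⟨b, hb⟩ := hex (P i φ₁) hφ₁
  rw [hPs] at hb
  obtain ⟨N₁, hN₁⟩ := exists_nat_ge |E|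
  obtain ⟨N₂, hN₂⟩ := exists_nat_ge ‖inner ℂ ψ₁ (u a)‖⁻¹
  obtain ⟨N₃, hN₃⟩ := exists_nat_ge ‖inner ℂ φ₁ (P i (u b))‖⁻¹
  have hcast : ((N₁ + N₂ + N₃ : ℕ) : ℝ) = N₁ + N₂ + N₃ := by push_cast; ring
  have p1 : (0 : ℝ) ≤ N₁ := N₁.cast_nonneg
  have p2 : (0 : ℝ) ≤ N₂ := N₂.cast_nonneg
  have p3 : (0 : ℝ) ≤ N₃ := N₃.cast_nonneg
  -- One `N` serves three purposes: it bounds `|E|` and the inverses of both test values.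
  refine ⟨N₁ + N₂ + N₃, a, b, E, ?_, StrongDual.toWeakDual (InnerProductSpace.toDual ℂ H ψ₁), ?_,
    StrongDual.toWeakDual (InnerProductSpace.toDual ℂ H φ₁), ?_,
    (isDualSolution_toDual_iff hT hPs).2 (hψ.smul _),
    (isDualSolution_toDual_iff hT hPs).2 (hφ.smul _), ?_, ?_, ?_⟩
  · rw [Set.mem_Icc, ← abs_le]
    linarith
  · rw [Set.mem_preimage, mem_closedBall_zero_iff]
    exact ((InnerProductSpace.toDual ℂ H).norm_map ψ₁).trans_le (hunit ψ h0)
  · rw [Set.mem_preimage, mem_closedBall_zero_iff]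
    exact ((InnerProductSpace.toDual ℂ H).norm_map φ₁).trans_le (hunit φ hφ0)
  · intro g
    simp only [StrongDual.toWeakDual_apply, InnerProductSpace.toDual_apply_apply]
    rw [← hPs, hi₁, inner_zero_left]
  · simp only [StrongDual.toWeakDual_apply, InnerProductSpace.toDual_apply_apply]
    rw [← inv_le_iff_one_le_mul₀ (norm_pos_iff.2 ha)]
    linarith
  · simp only [StrongDual.toWeakDual_apply, InnerProductSpace.toDual_apply_apply]
    rw [← inv_le_iff_one_le_mul₀ (norm_pos_iff.2 hb)]
    linarith

theorem exists_solutions_of_mem_resonanceSet (hT : ∀ x y, inner ℂ (T x) y = inner ℂ x (T y))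
    (hPs : ∀ j x y, inner ℂ (P j x) y = inner ℂ x (P j y)) {w : ι → ℝ} {i : ι} {N : ℕ} {u v : H}
    (h : w ∈ resonanceSet T P i N u v) :
    ∃ E ψ φ, IsComponentwiseSolution T P w E ψ ∧ IsComponentwiseSolution T P w E φ ∧
      ψ ≠ 0 ∧ P i ψ = 0 ∧ P i φ ≠ 0 := by
  obtain ⟨E, -, f, -, f', -, hf, hf', hi, h1, h2⟩ := h
  -- Riesz representation turns the forms back into vectors.
  obtain ⟨ψ, rfl⟩ : ∃ ψ, StrongDual.toWeakDual (InnerProductSpace.toDual ℂ H ψ) = f :=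
    ⟨(InnerProductSpace.toDual ℂ H).symm (WeakDual.toStrongDual f), by
      rw [LinearIsometryEquiv.apply_symm_apply]; rfl⟩
  obtain ⟨φ, rfl⟩ : ∃ φ, StrongDual.toWeakDual (InnerProductSpace.toDual ℂ H φ) = f' :=
    ⟨(InnerProductSpace.toDual ℂ H).symm (WeakDual.toStrongDual f'), by
      rw [LinearIsometryEquiv.apply_symm_apply]; rfl⟩
  simp only [StrongDual.toWeakDual_apply, InnerProductSpace.toDual_apply_apply] at hi h1 h2
  refine ⟨E, ψ, φ, (isDualSolution_toDual_iff hT hPs).1 hf,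
    (isDualSolution_toDual_iff hT hPs).1 hf', ?_, ?_, ?_⟩
  · rintro rfl
    rw [inner_zero_left, norm_zero, mul_zero] at h1
    exact absurd h1 (by norm_num)
  · exact ext_inner_right ℂ fun g => by rw [hPs, hi, inner_zero_left]
  · intro h0
    rw [← hPs, h0, inner_zero_left, norm_zero, mul_zero] at h2
    exact absurd h2 (by norm_num)

end Abstract

/-! ### Independence and Fubini -/

section Probability

variable {Ω : Type*} [MeasurableSpace Ω] {μ : Measure Ω} {ι : Type*} {X : ι → Ω → ℝ}

/-- A member of an independent family is independent of the family of all the others. -/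
theorem indepFun_update [DecidableEq ι] (hX : ∀ i, Measurable (X i)) (hindep : iIndepFun X μ)
    (i : ι) : IndepFun (fun ω => Function.update (fun j => X j ω) i 0) (X i) μ := by
  have h := indep_iSup_of_disjoint (fun j => (hX j).comap_le) hindep
    (S := {i}ᶜ) (T := {i}) disjoint_compl_left
  rw [IndepFun_iff_Indep]
  refine indep_of_indep_of_le_left (indep_of_indep_of_le_right h ?_) ?_
  · exact le_iSup₂_of_le i rfl le_rfl
  -- Overwriting coordinate `i` by a constant leaves a function measurable for the σ-algebra
  -- generated by the other members.
  · refine measurable_iff_comap_le.1 (@measurable_pi_lambda _ _ _ (_) _ _ fun j => ?_)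
    rcases eq_or_ne j i with rfl | hj
    · simp only [Function.update_self]
      exact measurable_const
    · simp only [Function.update_of_ne hj]
      exact measurable_iff_comap_le.2 (le_iSup₂_of_le j hj le_rfl)

/-- A measurable set all of whose sections in direction `i` are countable is avoided almost surely
by an independent family with an atomless `i`-th member. -/
theorem ae_notMem_of_countable_sections [DecidableEq ι] [IsProbabilityMeasure μ]
    (hX : ∀ i, Measurable (X i)) (hindep : iIndepFun X μ) (i : ι) [NullSingletonClass (μ.map (X i))]
    {Z : Set (ι → ℝ)} (hZ : MeasurableSet Z)
    (hc : ∀ w : ι → ℝ, {t : ℝ | Function.update w i t ∈ Z}.Countable) :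
    ∀ᵐ ω ∂μ, (fun j => X j ω) ∉ Z := by
  set Y : Ω → ι → ℝ := fun ω => Function.update (fun j => X j ω) i 0
  have hY : Measurable Y := by
    refine measurable_pi_lambda _ fun j => ?_
    rcases eq_or_ne j i with rfl | hj
    · simp only [Y, Function.update_self]
      exact measurable_const
    · simp only [Y, Function.update_of_ne hj]
      exact hX j
  have hU : Measurable fun p : (ι → ℝ) × ℝ => Function.update p.1 i p.2 := by
    refine measurable_pi_lambda _ fun j => ?_
    rcases eq_or_ne j i with rfl | hj
    · simp only [Function.update_self]
      exact measurable_snd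
    · simp only [Function.update_of_ne hj]
      exact (measurable_pi_apply j).comp measurable_fst
  have hprod := (indepFun_iff_map_prod_eq_prod_map_map hY.aemeasurable (hX i).aemeasurable).1
    (indepFun_update hX hindep i)
  have : IsProbabilityMeasure (μ.map (X i)) := Measure.isProbabilityMeasure_map (hX i).aemeasurable
  -- The joint law is a product, so it suffices that each section in the last variable is null.
  have hnull : μ.map (fun ω => (Y ω, X i ω))
      ((fun p : (ι → ℝ) × ℝ => Function.update p.1 i p.2) ⁻¹' Z) = 0 := by
    rw [hprod, Measure.measure_prod_null (hU hZ)]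
    exact Filter.Eventually.of_forall fun w => (hc w).measure_zero _
  rw [Measure.map_apply (hY.prodMk (hX i)) (hU hZ)] at hnull
  have := measure_eq_zero_iff_ae_notMem.1 hnull
  filter_upwards [this] with ω hω hmem
  refine hω ?_
  -- Writing `X i ω` back into coordinate `i` of `Y ω` recovers the full configuration.
  simpa [Y] using hmem

/-- Almost surely, if some nonzero solution of energy `E` has a vanishing `i`-th component, then
all solutions of energy `E` have. -/
theorem ae_component_eq_zero {H : Type*} [NormedAddCommGroup H] [InnerProductSpace ℂ H]
    [CompleteSpace H] [TopologicalSpace.SeparableSpace H] [Countable ι]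
    {T : H →L[ℂ] H} {P : ι → H →L[ℂ] H}
    (hT : ∀ x y, inner ℂ (T x) y = inner ℂ x (T y))
    (hPs : ∀ j x y, inner ℂ (P j x) y = inner ℂ x (P j y))
    (hPi : ∀ j x, P j (P j x) = P j x)
    (hsum : ∀ x, HasSum (fun j => P j x) x) [IsProbabilityMeasure μ]
    (hX : ∀ i, Measurable (X i)) (hindep : iIndepFun X μ)
    (hat : ∀ i, NullSingletonClass (μ.map (X i))) :
    ∀ᵐ ω ∂μ, ∀ (i : ι) (E : ℝ) (ψ φ : H),
      IsComponentwiseSolution T P (fun j => X j ω) E ψ →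
      IsComponentwiseSolution T P (fun j => X j ω) E φ → ψ ≠ 0 → P i ψ = 0 → P i φ = 0 := by
  classical
  have h : ∀ᵐ ω ∂μ, ∀ (i : ι) (N a b : ℕ), (fun j => X j ω) ∉
      resonanceSet T P i N (TopologicalSpace.denseSeq H a) (TopologicalSpace.denseSeq H b) := by
    refine ae_all_iff.2 fun i => ae_all_iff.2 fun N => ae_all_iff.2 fun a => ae_all_iff.2 fun b => ?_
    have := hat i
    refine ae_notMem_of_countable_sections hX hindep i
      (isClosed_resonanceSet T P i N _ _).measurableSet fun w => ?_
    exact (countable_resonances hT hPs hPi hsum w i).mono fun t ht =>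
      exists_solutions_of_mem_resonanceSet hT hPs ht
  filter_upwards [h] with ω hω i E ψ φ hψ hφ h0 hi
  by_contra hne
  obtain ⟨N, a, b, hmem⟩ := mem_resonanceSet_of_solutions hT hPs
    (TopologicalSpace.denseRange_denseSeq H) hψ hφ h0 hi hne
  exact hω i N a b hmem

end Probability

end AndersonModel

namespace AndersonModel

/-! ### The Anderson Hamiltonian in the abstract setting -/

section Model

variable {d n : ℕ}

instance : TopologicalSpace.SeparableSpace (StateSpace d n) := by
  set S : Set (StateSpace d n) := ⋃ x : Fin d → ℤ,
    Set.range fun v : EuclideanSpace ℂ (Fin n) =>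
      (lp.single 2 x v : StateSpace d n)
  have hS : TopologicalSpace.IsSeparable S := by
    refine TopologicalSpace.IsSeparable.iUnion fun x => TopologicalSpace.isSeparable_range ?_
    exact (lp.isometry_single (E := fun _ : Fin d → ℤ => EuclideanSpace ℂ (Fin n)) (p := 2)
      x).continuous
  have hcl := (hS.span (R := ℂ)).closure
  rw [← TopologicalSpace.isSeparable_univ_iff]
  refine hcl.mono fun f _ => ?_
  refine mem_closure_of_tendsto (lp.hasSum_single ENNReal.ofNat_ne_top f)
    (Filter.Eventually.of_forall fun s => ?_)
  exact Submodule.sum_mem _ fun x _ =>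
    Submodule.subset_span (Set.mem_iUnion.2 ⟨x, f x, rfl⟩)

theorem inner_translation_left (i : Fin d → ℤ) (f g : StateSpace d n) :
    inner ℂ (translation i f) g = inner ℂ f (translation (-i) g) := by
  have h : translation i (translation (-i) g) = g := by
    ext1; funext k; simp
  conv_lhs => rw [← h]
  exact LinearIsometryEquiv.inner_map_map _ _ _

theorem inner_fiberOperator_left {A : Matrix (Fin n) (Fin n) ℂ} (hA : A.IsHermitian)
    (f g : StateSpace d n) :
    inner ℂ (fiberOperator A f) g = inner ℂ f (fiberOperator A g) := by
  rw [lp.inner_eq_tsum, lp.inner_eq_tsum]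
  refine tsum_congr fun k => ?_
  rw [fiberOperator_apply, fiberOperator_apply]
  have h : IsSelfAdjoint (Matrix.toEuclideanCLM (𝕜 := ℂ) A) := by
    rw [IsSelfAdjoint, ← map_star]
    exact congrArg _ hA
  exact ContinuousLinearMap.isSelfAdjoint_iff_isSymmetric.1 h _ _

theorem inner_laplacian_left {A : Matrix (Fin n) (Fin n) ℂ} (hA : A.IsHermitian)
    (f g : StateSpace d n) : inner ℂ (laplacian A f) g = inner ℂ f (laplacian A g) := by
  have hcomm : ∀ (i : Fin d → ℤ) (h : StateSpace d n),
      fiberOperator A (translation i h) = translation i (fiberOperator A h) := fun _ _ => rfl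
  have happ : ∀ h : StateSpace d n, laplacian A h = ∑ a : Fin d,
      (translation (Pi.single a 1) (fiberOperator A h) +
        translation (-Pi.single a 1) (fiberOperator A h)) := fun h => by
    rw [laplacian, _root_.sum_apply]; rfl
  rw [happ, happ, sum_inner, inner_sum]
  -- Taking adjoints exchanges the shifts by `eₐ` and `-eₐ`, so each pair is symmetric.
  refine Finset.sum_congr rfl fun a _ => ?_
  rw [inner_add_left, inner_add_right, inner_translation_left, inner_translation_left, neg_neg,
    inner_fiberOperator_left hA, inner_fiberOperator_left hA, hcomm, hcomm, add_comm]

variable {J : AddSubgroup (Fin d → ℤ)} {P₀ : StateSpace d n →L[ℂ] StateSpace d n}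

theorem inner_translatedProjection_left (hP₀ : IsStarProjection P₀) (i : Fin d → ℤ)
    (f g : StateSpace d n) :
    inner ℂ (translatedProjection P₀ i f) g = inner ℂ f (translatedProjection P₀ i g) := by
  rw [inner_translatedProjection hP₀, ← inner_conj_symm, inner_translatedProjection hP₀,
    inner_conj_symm]

theorem translatedProjection_idem (hP₀ : IsStarProjection P₀) (i : Fin d → ℤ)
    (f : StateSpace d n) :
    translatedProjection P₀ i (translatedProjection P₀ i f) = translatedProjection P₀ i f := by
  refine ext_inner_left ℂ fun v => ?_
  rw [← inner_translatedProjection_left hP₀, ← inner_translatedProjection hP₀]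

/-- Distinct translates of the projection have orthogonal ranges. -/
theorem translatedProjection_comp_eq_zero (hP₀ : IsStarProjection P₀)
    (hsum : ∀ f, HasSum (fun i : J => translatedProjection P₀ (i : Fin d → ℤ) f) f)
    {i j : J} (hij : i ≠ j) (f : StateSpace d n) :
    translatedProjection P₀ (i : Fin d → ℤ) (translatedProjection P₀ (j : Fin d → ℤ) f) = 0 := by
  classical
  -- For `g = Pⱼ f` the two terms `‖Pᵢ g‖² + ‖Pⱼ g‖²` are at most `‖g‖²`, and the second already
  -- equals it.
  have h := sum_le_hasSum {i, j} (fun _ _ => by positivity)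
    (hasSum_norm_sq hP₀ hsum (translatedProjection P₀ (j : Fin d → ℤ) f))
  rw [Finset.sum_pair hij, translatedProjection_idem hP₀] at h
  have h0 : ‖translatedProjection P₀ (i : Fin d → ℤ)
      (translatedProjection P₀ (j : Fin d → ℤ) f)‖ ^ 2 = 0 :=
    le_antisymm (by linarith) (sq_nonneg _)
  exact norm_eq_zero.1 (pow_eq_zero_iff two_ne_zero |>.1 h0)

/-- Eigenvectors of the Hamiltonian solve the eigenvalue equation componentwise. -/
theorem isComponentwiseSolution_of_hamiltonian_eq (hP₀ : IsStarProjection P₀)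
    (hsum : ∀ f, HasSum (fun i : J => translatedProjection P₀ (i : Fin d → ℤ) f) f)
    {A : Matrix (Fin n) (Fin n) ℂ} {w : J → ℝ} {C : ℝ} (hw : ∀ i, |w i| ≤ C) {E : ℝ}
    {ψ : StateSpace d n} (h : hamiltonian A J P₀ w ψ = (E : ℂ) • ψ) :
    IsComponentwiseSolution (laplacian A)
      (fun i : J => translatedProjection P₀ (i : Fin d → ℤ)) w E ψ := by
  intro j
  have h1 := (potential_hasSum hP₀ hsum hw ψ).mapL (translatedProjection P₀ (j : Fin d → ℤ))
  -- By orthogonality `Pⱼ` retains only the `j`-th term of the potential.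
  have h2 := h1.unique (hasSum_single j fun i hi => by
    rw [map_smul, translatedProjection_comp_eq_zero hP₀ hsum hi.symm, smul_zero])
  rw [map_smul, translatedProjection_idem hP₀] at h2
  have h3 : laplacian A ψ + potential J P₀ w ψ = (E : ℂ) • ψ := h
  have h4 : laplacian A ψ = (E : ℂ) • ψ - potential J P₀ w ψ := eq_sub_of_add_eq h3
  rw [h4, map_sub, map_smul, h2, Complex.ofReal_sub, sub_smul]

theorem rank_translatedProjection_le (P₀ : StateSpace d n →L[ℂ] StateSpace d n)
    (i : Fin d → ℤ) :
    (translatedProjection P₀ i : StateSpace d n →ₗ[ℂ] StateSpace d n).rank ≤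
      (P₀ : StateSpace d n →ₗ[ℂ] StateSpace d n).rank :=
  (LinearMap.rank_comp_le_right
    ((P₀ : StateSpace d n →ₗ[ℂ] StateSpace d n) ∘ₗ
      ((translation (n := n) i).symm.toLinearEquiv : StateSpace d n →ₗ[ℂ] StateSpace d n))
    ((translation (n := n) i).toLinearEquiv : StateSpace d n →ₗ[ℂ] StateSpace d n)).trans
  (LinearMap.rank_comp_le_left _ _)

/-- A subspace whose dimension exceeds the rank of a linear map meets its kernel. -/
theorem exists_mem_ne_zero_map_eq_zero {V : Type*} [AddCommGroup V] [Module ℂ V]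
    (f : V →ₗ[ℂ] V) (W : Submodule ℂ V) (h : f.rank < Module.rank ℂ W) :
    ∃ x ∈ W, x ≠ 0 ∧ f x = 0 := by
  by_contra! hcon
  refine h.not_ge ?_
  refine LinearMap.rank_le_of_injective (f.rangeRestrict ∘ₗ W.subtype) ?_
  rw [← LinearMap.ker_eq_bot, LinearMap.ker_eq_bot']
  intro x hx
  by_contra h0
  exact hcon x x.2 (fun h => h0 (Subtype.ext h)) (congrArg Subtype.val hx)

end Model

/-! ### Almost sure bounds and the conclusion -/

/-- A random variable with a compactly supported density is almost surely bounded by a constant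
that depends on the density only. -/
theorem exists_ae_abs_le {Ω : Type*} [MeasurableSpace Ω] {μ : Measure Ω} {ρ : ℝ → ℝ}
    (hρ : HasCompactSupport ρ) :
    ∃ C : ℝ, ∀ Y : Ω → ℝ, Measurable Y →
      μ.map Y = volume.withDensity (fun t => ENNReal.ofReal (ρ t)) → ∀ᵐ ω ∂μ, |Y ω| ≤ C := by
  obtain ⟨C, hC⟩ := hρ.isCompact.isBounded.exists_norm_le
  refine ⟨C, fun Y hY hlaw => ?_⟩
  have hms : MeasurableSet {t : ℝ | ¬ |t| ≤ C} :=
    (measurableSet_le measurable_abs measurable_const).compl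
  have h : μ.map Y {t : ℝ | ¬ |t| ≤ C} = 0 := by
    rw [hlaw, withDensity_apply _ hms]
    refine (setLIntegral_congr_fun hms fun t ht => ?_).trans lintegral_zero
    have : ρ t = 0 := by
      by_contra h0
      exact ht (hC t (subset_tsupport ρ h0))
    simp [this]
  rwa [Measure.map_apply hY hms] at h

/-- Almost surely, all eigenvalues of the Anderson Hamiltonian have multiplicity at most the rank
of the single-site projection. Localization plays no role: if the eigenspace of `E` is larger than
that, it meets the kernel of each `Pᵢ`, so `E` lies in a countable set that does not depend on the
`i`-th coupling constant, and then almost surely `Pᵢ` vanishes on the whole eigenspace. -/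
theorem ae_rank_eigenspace_le {d n m : ℕ}
    (A : Matrix (Fin n) (Fin n) ℂ) (hA : A.IsHermitian)
    (J : AddSubgroup (Fin d → ℤ))
    (P₀ : StateSpace d n →L[ℂ] StateSpace d n)
    (hP₀ : IsStarProjection P₀)
    (hrank : (P₀ : StateSpace d n →ₗ[ℂ] StateSpace d n).rank = m)
    (hsum : ∀ f : StateSpace d n,
      HasSum (fun i : J => translatedProjection P₀ (i : Fin d → ℤ) f) f)
    {Ω : Type*} [MeasurableSpace Ω] (μ : Measure Ω) [IsProbabilityMeasure μ]
    (X : J → Ω → ℝ) (hX : ∀ i, Measurable (X i)) (hindep : iIndepFun X μ)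
    (ρ : ℝ → ℝ) (hρ_supp : HasCompactSupport ρ)
    (hlaw : ∀ i, μ.map (X i) = volume.withDensity (fun t => ENNReal.ofReal (ρ t))) :
    ∀ᵐ ω ∂μ, ∀ E : ℝ,
        Module.rank ℂ (Module.End.eigenspace
          (hamiltonian A J P₀ (fun i => X i ω) :
            StateSpace d n →ₗ[ℂ] StateSpace d n) (E : ℂ)) ≤ m := by
  obtain ⟨C, hC⟩ := exists_ae_abs_le (μ := μ) hρ_supp
  -- A uniform bound guarantees that `potential` is the strong sum and not its default value `0`.
  have hbdd : ∀ᵐ ω ∂μ, ∀ i, |X i ω| ≤ C := ae_all_iff.2 fun i => hC (X i) (hX i) (hlaw i)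
  have hat : ∀ i, NullSingletonClass (μ.map (X i)) := fun i => by
    rw [hlaw i]; infer_instance
  have hmain := ae_component_eq_zero (μ := μ) (X := X) (T := laplacian A)
    (P := fun i : J => translatedProjection P₀ (i : Fin d → ℤ)) (inner_laplacian_left hA)
    (fun j => inner_translatedProjection_left hP₀ j) (fun j => translatedProjection_idem hP₀ j)
    hsum hX hindep hat
  filter_upwards [hbdd, hmain] with ω hb hω E
  by_contra! hlt
  have hsol : ∀ ψ ∈ Module.End.eigenspace
      (hamiltonian A J P₀ (fun i => X i ω) : StateSpace d n →ₗ[ℂ] StateSpace d n) (E : ℂ),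
      IsComponentwiseSolution (laplacian A)
        (fun i : J => translatedProjection P₀ (i : Fin d → ℤ)) (fun i => X i ω) E ψ := fun ψ hψ =>
    isComponentwiseSolution_of_hamiltonian_eq hP₀ hsum hb (Module.End.mem_eigenspace_iff.1 hψ)
  have hex : ∀ i : J, ∃ ψ ∈ Module.End.eigenspace
      (hamiltonian A J P₀ (fun i => X i ω) : StateSpace d n →ₗ[ℂ] StateSpace d n) (E : ℂ),
      ψ ≠ 0 ∧ translatedProjection P₀ (i : Fin d → ℤ) ψ = 0 := fun i =>
    exists_mem_ne_zero_map_eq_zero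
      (translatedProjection P₀ (i : Fin d → ℤ) : StateSpace d n →ₗ[ℂ] StateSpace d n) _
      (((rank_translatedProjection_le P₀ i).trans_eq hrank).trans_lt hlt)
  -- The site `0` only supplies some nonzero eigenvector; all its components will be shown to
  -- vanish.
  obtain ⟨φ, hφ, hφ0, -⟩ := hex 0
  refine hφ0 ((hsum φ).unique ?_)
  convert (hasSum_zero : HasSum (fun _ : J => (0 : StateSpace d n)) 0) using 2 with i
  obtain ⟨ψ, hψ, hψ0, hi⟩ := hex i
  exact hω i E ψ φ (hsol ψ hψ) (hsol φ hφ) hψ0 hi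

end AndersonModel

theorem theorem5p3 {d n m : ℕ} (hd : 1 ≤ d) (hm : 1 ≤ m)
    (A : Matrix (Fin n) (Fin n) ℂ) (hA : A.PosDef)
    (J : AddSubgroup (Fin d → ℤ))
    (P₀ : AndersonModel.StateSpace d n →L[ℂ] AndersonModel.StateSpace d n)
    (hP₀ : IsStarProjection P₀)
    (hrank : (P₀ : AndersonModel.StateSpace d n →ₗ[ℂ] AndersonModel.StateSpace d n).rank = m)
    (hsum : ∀ f : AndersonModel.StateSpace d n,
      HasSum (fun i : J => AndersonModel.translatedProjection P₀ (i : Fin d → ℤ) f) f)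
    {Ω : Type*} [MeasurableSpace Ω] (μ : Measure Ω) [IsProbabilityMeasure μ]
    (X : J → Ω → ℝ) (hX : ∀ i, Measurable (X i)) (hindep : iIndepFun X μ)
    (ρ : ℝ → ℝ) (hρ : Measurable ρ) (hρ_nonneg : ∀ t, 0 ≤ ρ t)
    (hρ_bdd : ∃ C : ℝ, ∀ t, ρ t ≤ C) (hρ_supp : HasCompactSupport ρ)
    (hlaw : ∀ i, μ.map (X i) = volume.withDensity (fun t => ENNReal.ofReal (ρ t))) :
    ∀ᵐ ω ∂μ,
      ∀ E ∈ AndersonModel.localizationRegion μ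
          (fun ω' => AndersonModel.hamiltonian A J P₀ (fun i => X i ω')),
        Module.rank ℂ (Module.End.eigenspace
          (AndersonModel.hamiltonian A J P₀ (fun i => X i ω) :
            AndersonModel.StateSpace d n →ₗ[ℂ] AndersonModel.StateSpace d n) (E : ℂ)) ≤ m := by
  filter_upwards [AndersonModel.ae_rank_eigenspace_le A hA.isHermitian J P₀ hP₀ hrank hsum μ X hX
    hindep ρ hρ_supp hlaw] with ω hω E _
  exact hω E
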